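/- **Setting.** Time is integral. A *sporadic DAG task system* is a family $\tau=(\tau_1,\dots,\tau_n)$ of independent tasks. Task $\tau_i$ consists of a finite directed acyclic graph of subtasks, a worst-case execution time $e_i^v\ge 1$ for every subtask $v$, a period $p_i\ge 1$, and a relative deadline equal to $p_i$; one longest chain (maximal sum of execution times) of the graph is selected as its critical path $\mathrm{Cpath}_i$. Put $C_i=\sum_v e_i^v$, $u_i=C_i/p_i$, $\sigma_i=\mathrm{len}(\mathrm{Cpath}_i)/p_i$, $U_{sum}=\sum_i u_i$, $u_{max}(\tau)=\max_i u_i$, $\sigma_{max}(\tau)=\max_i\sigma_i$. Task $\tau_i$ releases an infinite sequence of dag-jobs, at times at least $p_i$ apart; a dag-job released at $r$ consists of one job of each subtask $v$, requiring between $1$ and $e_i^v$ units of execution, and has absolute deadline $r+p_i$. A released, uncompleted job is *ready* when all its predecessor jobs and all earlier dag-jobs of the same task have completed. *CP-GEDF* on $M$ identical processors is the preemptive, work-conserving global scheduling strategy that at each instant executes the (at most $M$) ready jobs of highest priority, where an earlier dag-job deadline means higher priority, ties between tasks are broken in favour of the lower task index, and within one dag-job the jobs of subtasks not on the critical path have priority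 over those on it (the order of the former is arbitrary). The system is *schedulable* on $M$ processors under CP-GEDF if, for all such release and execution times and in every resulting CP-GEDF schedule, every dag-job completes by its deadline. For tasks $k,i$ let $\eta_i^{(k)}=u_i$ if $\sigma_k\ge u_i$, and $\eta_i^{(k)}=u_i+\frac{C_i-\sigma_k p_i}{p_k}$ if $\sigma_k<u_i$. The *DAG test at $\tau_k$* is the inequality $\sum_{i=1}^n\eta_i^{(k)}\le M-(M-1)\sigma_k$; the *DAG test* requires it for every $k$. The *density test* is the inequality $U_{sum}\le M-(M-1)\,u_{max}(\tau)$. **Lemma.** Let $M\ge 1$ and let every DAG task of $\tau$ consist of a single subtask. 1. If $U_{sum}\le M-(M-1)\,u_{max}(\tau)$, then $\tau$ is schedulable on $M$ identical processors under CP-GEDF. 2. Moreover, $\sigma_i=u_i$ for all $i$ and $\sigma_{max}(\tau)=u_{max}(\tau)$; for every task $\tau_k$ with $\sigma_k=\sigma_{max}(\tau)$ the DAG test at $\tau_k$ is equivalent to the density test; and the DAG test implies the density test. -/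

import Mathlib

/-- A sporadic DAG task with implicit deadline. Its subtasks are indexed by `Fin size`, an edge
`edge v w` makes `v` a predecessor of `w`, and `cpath` is the longest chain that has been selected
as the critical path of the DAG (if there are several longest chains, any one of them). -/
structure DagTask where
  /-- number of subtasks -/
  size : ℕ
  /-- precedence edges between subtasks -/
  edge : Fin size → Fin size → Prop
  acyclic : ∀ v, ¬ Relation.TransGen edge v v
  /-- worst case execution time of each subtask -/
  wcet : Fin size → ℕ
  wcet_pos : ∀ v, 0 < wcet v
  /-- period (minimum separation of releases) -/
  period : ℕ
  period_pos : 0 < period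
  /-- the selected critical path -/
  cpath : List (Fin size)
  cpath_ne_nil : cpath ≠ []
  cpath_isChain : cpath.IsChain edge
  cpath_longest : ∀ l : List (Fin size), l.IsChain edge → (l.map wcet).sum ≤ (cpath.map wcet).sum

namespace DagTask

/-- The relative deadline; deadlines are implicit, i.e. equal to the period. -/
def relDeadline (T : DagTask) : ℕ := T.period

/-- Length of the critical path. -/
def cpLen (T : DagTask) : ℕ := (T.cpath.map T.wcet).sum

/-- Total execution time `C`. -/
def totalWcet (T : DagTask) : ℕ := ∑ v, T.wcet v

/-- Utilization `u = C / p`. -/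
noncomputable def util (T : DagTask) : ℝ := (T.totalWcet : ℝ) / (T.period : ℝ)

/-- cp-utilization `σ = len(Cpath) / p`. -/
noncomputable def cpUtil (T : DagTask) : ℝ := (T.cpLen : ℝ) / (T.period : ℝ)

end DagTask

/-- A system of `n` independent sporadic DAG tasks; the index of a task is its ID. -/
abbrev DagSystem (n : ℕ) : Type := Fin n → DagTask

namespace DagSystem

variable {n : ℕ}

/-- Total utilization of the system. -/
noncomputable def utilSum (τ : DagSystem n) : ℝ := ∑ i, (τ i).util

/-- Maximum task utilization (a maximum over the finitely many tasks). -/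
noncomputable def utilMax (τ : DagSystem n) : ℝ := ⨆ i, (τ i).util

/-- Maximum cp-utilization (a maximum over the finitely many tasks). -/
noncomputable def cpUtilMax (τ : DagSystem n) : ℝ := ⨆ i, (τ i).cpUtil

/-- The job `idx` (counted from `0`) of subtask `sub` of task `task`. The dag-job `idx` of a task
consists of the jobs `idx` of all its subtasks. -/
structure Job (τ : DagSystem n) where
  task : Fin n
  idx : ℕ
  sub : Fin (τ task).size

/-- The run-time behaviour of the system that is not controlled by the scheduler: a legal sporadic
pattern of release times, and actual execution times, bounded by the worst case. Time is
integral. -/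
structure Behaviour (τ : DagSystem n) where
  release : Fin n → ℕ → ℕ
  release_sep : ∀ i j, release i j + (τ i).period ≤ release i (j + 1)
  exec : τ.Job → ℕ
  exec_pos : ∀ J, 0 < exec J
  exec_le : ∀ J, exec J ≤ (τ J.task).wcet J.sub

/-- A schedule: the finite set of jobs executing in each unit slot `[t, t + 1)`. A job occupies one
processor while it executes; preemption and migration take place at integral times. -/
abbrev Schedule (τ : DagSystem n) : Type := ℕ → Finset τ.Job

open scoped Classical in
/-- Amount of execution received by `J` in `[0, t)`. -/
noncomputable def received {τ : DagSystem n} (S : τ.Schedule) (J : τ.Job) (t : ℕ) : ℕ :=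
  ((Finset.range t).filter (fun s => J ∈ S s)).card

namespace Behaviour

variable {τ : DagSystem n}

/-- Absolute deadline of dag-job `j` of task `i`. -/
def deadline (B : τ.Behaviour) (i : Fin n) (j : ℕ) : ℕ := B.release i j + (τ i).relDeadline

/-- `J` has completed by time `t`. -/
def Completed (B : τ.Behaviour) (S : τ.Schedule) (J : τ.Job) (t : ℕ) : Prop :=
  B.exec J ≤ received S J t

/-- All jobs of dag-job `j` of task `i` have completed by time `t`. -/
def DagJobCompleted (B : τ.Behaviour) (S : τ.Schedule) (i : Fin n) (j t : ℕ) : Prop :=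
  ∀ v, B.Completed S ⟨i, j, v⟩ t

/-- `J` is ready at time `t`: it is released and not completed, all its predecessor jobs have
completed, and so have all earlier dag-jobs of the same task (successive dag-jobs of a task
execute in sequence). -/
def Ready (B : τ.Behaviour) (S : τ.Schedule) (J : τ.Job) (t : ℕ) : Prop :=
  B.release J.task J.idx ≤ t ∧
  ¬ B.Completed S J t ∧
  (∀ w, (τ J.task).edge w J.sub → B.Completed S ⟨J.task, J.idx, w⟩ t) ∧
  (∀ j < J.idx, B.DagJobCompleted S J.task j t)

/-- `J` has higher priority than `K` under CP-GEDF: earlier dag-job deadline first, ties between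
different tasks are broken in favour of the lower task ID, and within a dag-job the jobs of
subtasks outside the critical path precede those on the critical path (no order is prescribed among
the former). -/
def HigherPriority (B : τ.Behaviour) (J K : τ.Job) : Prop :=
  B.deadline J.task J.idx < B.deadline K.task K.idx ∨
  (B.deadline J.task J.idx = B.deadline K.task K.idx ∧ J.task < K.task) ∨
  (J.task = K.task ∧ J.idx = K.idx ∧
    J.sub ∉ (τ J.task).cpath ∧ K.sub ∈ (τ K.task).cpath)

/-- `S` is a (preemptive, global, work-conserving) CP-GEDF schedule on `M` identical processors. -/
structure IsCPGEDF (B : τ.Behaviour) (M : ℕ) (S : τ.Schedule) : Prop where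
  card_le : ∀ t, (S t).card ≤ M
  ready : ∀ t, ∀ J ∈ S t, B.Ready S J t
  work_conserving : ∀ t J, B.Ready S J t → J ∉ S t → (S t).card = M
  priority : ∀ t J, B.Ready S J t → J ∉ S t → ∀ K ∈ S t, ¬ B.HigherPriority J K

end Behaviour

/-- The system is (hard real-time) schedulable on `M` processors under CP-GEDF: whatever the legal
releases and execution times, and however CP-GEDF resolves the choices left open, every dag-job
completes by its deadline. -/
def Schedulable (τ : DagSystem n) (M : ℕ) : Prop :=
  ∀ (B : τ.Behaviour) (S : τ.Schedule), B.IsCPGEDF M S →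
    ∀ (i : Fin n) (j : ℕ), B.DagJobCompleted S i j (B.deadline i j)

open scoped Classical in
/-- The bound `η_i` on the average workload of task `i`, relative to task `k`. -/
noncomputable def eta (τ : DagSystem n) (k i : Fin n) : ℝ :=
  if (τ i).util ≤ (τ k).cpUtil then (τ i).util
  else (τ i).util +
    (((τ i).totalWcet : ℝ) - (τ k).cpUtil * ((τ i).period : ℝ)) / ((τ k).period : ℝ)

/-- The DAG test for one task `k`. -/
def DagTestAt (τ : DagSystem n) (M : ℕ) (k : Fin n) : Prop :=
  ∑ i, τ.eta k i ≤ (M : ℝ) - ((M : ℝ) - 1) * (τ k).cpUtil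

/-- The DAG test: the inequality is required for every task. -/
def DagTest (τ : DagSystem n) (M : ℕ) : Prop := ∀ k, τ.DagTestAt M k

/-- The density test. -/
def DensityTest (τ : DagSystem n) (M : ℕ) : Prop :=
  τ.utilSum ≤ (M : ℝ) - ((M : ℝ) - 1) * τ.utilMax

end DagSystem

/-! The schedule is compared with a fluid one that runs each job at a constant rate from release to
deadline. The core is `IsCPGEDF.sum_fluid_le_sum_received`: among jobs due by `d`, total service up
to any time `t ≤ d` is at least the fluid total. Otherwise some such job lags its fluid service at
`t`. It has then been ready since its release `r`, so each slot in `[r, t)` serves it or fills all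
`M` processors with jobs due by `d`. As it got less than `u_max * (t - r)`, total service grew by at
least `(M - (M - 1) * u_max) * (t - r) ≥ U_sum * (t - r)`, which bounds the fluid growth; strong
induction supplies the inequality at `r`. At `t = d` the fluid schedule has finished all these jobs,
hence so has CP-GEDF. -/

namespace DagTask

theorem subsingleton_of_size {T : DagTask} (h : T.size = 1) (v w : Fin T.size) : v = w := by
  apply Fin.ext
  omega

theorem not_edge_of_size {T : DagTask} (h : T.size = 1) (v w : Fin T.size) : ¬ T.edge v w := by
  intro e
  obtain rfl := subsingleton_of_size h v w
  exact T.acyclic v (.single e)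

/-- An edge on one vertex would be a loop, so acyclicity leaves only one-vertex nonempty chains. -/
theorem cpLen_eq_totalWcet {T : DagTask} (h : T.size = 1) : T.cpLen = T.totalWcet := by
  have hc := T.cpath_isChain
  unfold cpLen totalWcet
  match hp : T.cpath with
  | [] => exact absurd hp T.cpath_ne_nil
  | [v] =>
    rw [Finset.sum_eq_single v]
    · simp
    · exact fun b _ hb => absurd (subsingleton_of_size h b v) hb
    · simp
  | v :: w :: l =>
    rw [hp, List.isChain_cons_cons] at hc
    exact absurd hc.1 (not_edge_of_size h v w)

theorem cpUtil_eq_util {T : DagTask} (h : T.size = 1) : T.cpUtil = T.util := by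
  rw [cpUtil, util, cpLen_eq_totalWcet h]

end DagTask

namespace DagSystem

variable {n : ℕ} {τ : DagSystem n}

theorem util_le_utilMax (τ : DagSystem n) (i : Fin n) : (τ i).util ≤ τ.utilMax :=
  le_ciSup (f := fun i => (τ i).util) (Set.finite_range _).bddAbove i

theorem received_succ (S : τ.Schedule) (J : τ.Job) (t : ℕ) [Decidable (J ∈ S t)] :
    received S J (t + 1) = received S J t + if J ∈ S t then 1 else 0 := by
  unfold received
  rw [Finset.range_add_one, Finset.filter_insert]
  split_ifs <;> simp

theorem received_mono (S : τ.Schedule) (J : τ.Job) : Monotone (received S J) := by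
  classical
  exact monotone_nat_of_le_succ fun t => by rw [received_succ]; omega

namespace Behaviour

variable (B : τ.Behaviour)

theorem Completed.mono {B : τ.Behaviour} {S : τ.Schedule} {J : τ.Job} {s t : ℕ}
    (h : B.Completed S J s) (hst : s ≤ t) : B.Completed S J t :=
  le_trans h (received_mono S J hst)

theorem deadline_le_release_of_lt (i : Fin n) {j k : ℕ} (h : j < k) :
    B.deadline i j ≤ B.release i k := by
  have hm : Monotone (B.release i) :=
    monotone_nat_of_le_succ fun j => le_trans (Nat.le_add_right _ _) (B.release_sep i j)
  exact (B.release_sep i j).trans (hm h)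

/-- Periods are positive integers; this makes the set of dag-jobs due by a given time finite. -/
theorem idx_le_release (i : Fin n) (j : ℕ) : j ≤ B.release i j := by
  induction j with
  | zero => exact Nat.zero_le _
  | succ j ih =>
    have := B.release_sep i j
    have := (τ i).period_pos
    omega

/-! ### The fluid reference schedule -/

/-- The constant rate at which a job completes exactly at its deadline. -/
noncomputable def rate (J : τ.Job) : ℝ := (B.exec J : ℝ) / ((τ J.task).period : ℝ)

theorem rate_nonneg (J : τ.Job) : 0 ≤ B.rate J := by unfold rate; positivity

theorem rate_le_util (J : τ.Job) : B.rate J ≤ (τ J.task).util := by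
  unfold rate DagTask.util
  gcongr
  exact (B.exec_le J).trans
    (Finset.single_le_sum (f := (τ J.task).wcet) (fun _ _ => Nat.zero_le _) (Finset.mem_univ J.sub))

/-- Execution received by `J` before `t` in the fluid schedule, which executes every job at its
constant rate between its release and its deadline. -/
noncomputable def fluid (J : τ.Job) (t : ℕ) : ℝ :=
  B.rate J * (min (t - B.release J.task J.idx) (τ J.task).period : ℕ)

theorem fluid_deadline (J : τ.Job) {t : ℕ} (h : B.deadline J.task J.idx ≤ t) :
    B.fluid J t = B.exec J := by
  have hp := (τ J.task).period_pos
  unfold deadline DagTask.relDeadline at h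
  unfold fluid rate
  rw [min_eq_right (by omega)]
  field_simp

theorem fluid_le_exec (J : τ.Job) (t : ℕ) : B.fluid J t ≤ B.exec J := by
  rw [← B.fluid_deadline J le_rfl]
  unfold fluid deadline DagTask.relDeadline
  apply mul_le_mul_of_nonneg_left _ (B.rate_nonneg J)
  exact_mod_cast by omega

theorem fluid_le_util_mul (J : τ.Job) (t : ℕ) :
    B.fluid J t ≤ (τ J.task).util * (t - B.release J.task J.idx : ℕ) := by
  unfold fluid
  apply mul_le_mul (B.rate_le_util J) _ (by positivity) ((B.rate_nonneg J).trans (B.rate_le_util J))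
  exact_mod_cast min_le_left _ _

theorem fluid_succ (J : τ.Job) (t : ℕ) :
    B.fluid J (t + 1) = B.fluid J t +
      if B.release J.task J.idx ≤ t ∧ t < B.deadline J.task J.idx then B.rate J else 0 := by
  unfold fluid deadline DagTask.relDeadline
  split_ifs with h
  · rw [show min (t + 1 - B.release J.task J.idx) (τ J.task).period =
      min (t - B.release J.task J.idx) (τ J.task).period + 1 by omega]
    push_cast
    ring
  · rw [show min (t + 1 - B.release J.task J.idx) (τ J.task).period =
      min (t - B.release J.task J.idx) (τ J.task).period by omega, add_zero]

/-- Indices (task, number) of the dag-jobs with deadline at most `d`. -/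
noncomputable def dueBy (d : ℕ) : Finset (Fin n × ℕ) :=
  (Finset.univ ×ˢ Finset.range (d + 1)).filter fun q => B.deadline q.1 q.2 ≤ d

theorem mem_dueBy {d : ℕ} {q : Fin n × ℕ} : q ∈ B.dueBy d ↔ B.deadline q.1 q.2 ≤ d := by
  unfold dueBy
  simp only [Finset.mem_filter, Finset.mem_product, Finset.mem_univ, Finset.mem_range, true_and,
    and_iff_right_iff_imp]
  intro h
  have := B.idx_le_release q.1 q.2
  unfold deadline at h
  omega

/-- At most one dag-job of a task lies between its release and its deadline at any time. -/
theorem eq_of_active {i : Fin n} {j k t : ℕ} (hj : B.release i j ≤ t) (hj' : t < B.deadline i j)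
    (hk : B.release i k ≤ t) (hk' : t < B.deadline i k) : j = k := by
  rcases lt_trichotomy j k with h | h | h
  · have := B.deadline_le_release_of_lt i h
    omega
  · exact h
  · have := B.deadline_le_release_of_lt i h
    omega

variable (v : ∀ i, Fin (τ i).size)

/-- Each task has at most one active job per slot, so the active rates inject into the tasks and are
bounded by their utilizations. -/
theorem sum_fluid_succ_le (I : Finset (Fin n × ℕ)) (t : ℕ) :
    ∑ q ∈ I, B.fluid ⟨q.1, q.2, v q.1⟩ (t + 1) ≤
      ∑ q ∈ I, B.fluid ⟨q.1, q.2, v q.1⟩ t + τ.utilSum := by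
  simp only [fluid_succ, Finset.sum_add_distrib]
  gcongr
  rw [← Finset.sum_filter]
  refine (Finset.sum_le_sum fun q _ => B.rate_le_util ⟨q.1, q.2, v q.1⟩).trans ?_
  rw [← Finset.sum_image (s := I.filter fun q => B.release q.1 q.2 ≤ t ∧ t < B.deadline q.1 q.2)
    (g := Prod.fst) (f := fun i => (τ i).util)]
  · exact Finset.sum_le_sum_of_subset_of_nonneg (Finset.subset_univ _)
      fun i _ _ => by unfold DagTask.util; positivity
  · rintro ⟨i, j⟩ hj ⟨i', k⟩ hk h
    obtain rfl : i = i' := h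
    simp only [Finset.coe_filter, Set.mem_ofPred_eq] at hj hk
    rw [B.eq_of_active hj.2.1 hj.2.2 hk.2.1 hk.2.2]

theorem sum_fluid_add_le (I : Finset (Fin n × ℕ)) (r m : ℕ) :
    ∑ q ∈ I, B.fluid ⟨q.1, q.2, v q.1⟩ (r + m) ≤
      ∑ q ∈ I, B.fluid ⟨q.1, q.2, v q.1⟩ r + τ.utilSum * m := by
  induction m with
  | zero => simp
  | succ m ih =>
    have := B.sum_fluid_succ_le v I (r + m)
    rw [← add_assoc]
    push_cast
    linarith

/-! ### CP-GEDF against the fluid schedule -/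

variable {B} {M : ℕ} {S : τ.Schedule}

theorem IsCPGEDF.received_le_exec (hS : B.IsCPGEDF M S) (J : τ.Job) (t : ℕ) :
    received S J t ≤ B.exec J := by
  classical
  induction t with
  | zero => simp [received]
  | succ t ih =>
    rw [received_succ]
    split_ifs with h
    · have := (hS.ready t J h).2.1
      unfold Completed at this
      omega
    · omega

/-- While a job due by `d` is ready, either it executes, or `M` jobs due by `d` execute. -/
theorem IsCPGEDF.le_card_executing (hsingle : ∀ i, (τ i).size = 1) (hS : B.IsCPGEDF M S) {d : ℕ}
    {p : Fin n × ℕ} (hp : p ∈ B.dueBy d) {s : ℕ} (hr : B.Ready S ⟨p.1, p.2, v p.1⟩ s)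
    [DecidablePred fun q : Fin n × ℕ => (⟨q.1, q.2, v q.1⟩ : τ.Job) ∈ S s]
    (hns : (⟨p.1, p.2, v p.1⟩ : τ.Job) ∉ S s) :
    M ≤ ((B.dueBy d).filter fun q => (⟨q.1, q.2, v q.1⟩ : τ.Job) ∈ S s).card := by
  classical
  rw [← hS.work_conserving s _ hr hns]
  apply Finset.card_le_card_of_surjOn fun q : Fin n × ℕ => (⟨q.1, q.2, v q.1⟩ : τ.Job)
  rintro ⟨i, j, w⟩ hK
  have hw : w = v i := DagTask.subsingleton_of_size (hsingle i) _ _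
  subst hw
  refine ⟨(i, j), ?_, rfl⟩
  have hpr := hS.priority s _ hr hns _ hK
  have hle : B.deadline i j ≤ B.deadline p.1 p.2 := not_lt.mp fun h => hpr (.inl h)
  simp only [Finset.coe_filter, Set.mem_ofPred_eq, mem_dueBy]
  exact ⟨hle.trans (B.mem_dueBy.mp hp), hK⟩

/-- A slot serves at least one job due by `d` if `p` runs and at least `M` if not: `M` minus `M - 1`
per slot given to `p`. -/
theorem IsCPGEDF.sum_received_add_ge (hsingle : ∀ i, (τ i).size = 1) (hS : B.IsCPGEDF M S) {d : ℕ}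
    {p : Fin n × ℕ} (hp : p ∈ B.dueBy d) (r m : ℕ)
    (hr : ∀ s, r ≤ s → s < r + m → B.Ready S ⟨p.1, p.2, v p.1⟩ s) :
    (∑ q ∈ B.dueBy d, (received S ⟨q.1, q.2, v q.1⟩ r : ℝ)) + M * m -
        (M - 1) * ((received S ⟨p.1, p.2, v p.1⟩ (r + m) : ℝ) -
          received S ⟨p.1, p.2, v p.1⟩ r) ≤
      ∑ q ∈ B.dueBy d, (received S ⟨q.1, q.2, v q.1⟩ (r + m) : ℝ) := by
  classical
  induction m with
  | zero => simp
  | succ m ih =>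
    have ih := ih fun s h₁ h₂ => hr s h₁ (by omega)
    have hrm := hr (r + m) (by omega) (by omega)
    rw [← add_assoc]
    simp only [received_succ S _ (r + m), Nat.cast_add, Nat.cast_ite, Nat.cast_one,
      Nat.cast_zero, Finset.sum_add_distrib, Finset.sum_boole]
    by_cases h : (⟨p.1, p.2, v p.1⟩ : τ.Job) ∈ S (r + m)
    · have hc : 1 ≤ ((B.dueBy d).filter
          fun q => (⟨q.1, q.2, v q.1⟩ : τ.Job) ∈ S (r + m)).card :=
        Finset.card_pos.mpr ⟨p, Finset.mem_filter.mpr ⟨hp, h⟩⟩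
      have hc' : (1 : ℝ) ≤ _ := Nat.one_le_cast.mpr hc
      rw [if_pos h]
      linarith
    · have hc' := Nat.cast_le (α := ℝ).mpr (hS.le_card_executing v hsingle hp hrm h)
      rw [if_neg h]
      linarith

/-- Under the density test, if all dag-jobs with deadline before `d` are on time, then at any time
up to `d` the jobs due by `d` have received at least as much execution in total as in the fluid
schedule. -/
theorem IsCPGEDF.sum_fluid_le_sum_received (hM : 1 ≤ M) (hsingle : ∀ i, (τ i).size = 1)
    (hU : τ.DensityTest M) (hS : B.IsCPGEDF M S) {d : ℕ}
    (hd : ∀ i j, B.deadline i j < d → B.DagJobCompleted S i j (B.deadline i j))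
    {t : ℕ} (ht : t ≤ d) :
    ∑ q ∈ B.dueBy d, B.fluid ⟨q.1, q.2, v q.1⟩ t ≤
      ∑ q ∈ B.dueBy d, (received S ⟨q.1, q.2, v q.1⟩ t : ℝ) := by
  induction t using Nat.strong_induction_on with
  | _ t ih =>
    by_contra hlt
    obtain ⟨p, hp, hpt⟩ := Finset.exists_lt_of_sum_lt (not_le.mp hlt)
    apply hlt
    have hinc : received S ⟨p.1, p.2, v p.1⟩ t < B.exec ⟨p.1, p.2, v p.1⟩ :=
      Nat.cast_lt (α := ℝ).mp (hpt.trans_le (B.fluid_le_exec _ t))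
    have hu := hpt.trans_le (B.fluid_le_util_mul _ t)
    set r := B.release p.1 p.2
    -- Before release the truncated difference is `0`, and service cannot be negative.
    have hrt : r < t := by
      by_contra h
      rw [Nat.sub_eq_zero_of_le (not_lt.mp h), Nat.cast_zero, mul_zero] at hu
      exact absurd hu (not_lt.mpr (Nat.cast_nonneg _))
    obtain ⟨m, rfl⟩ := Nat.exists_eq_add_of_le hrt.le
    rw [Nat.add_sub_cancel_left] at hu
    have hready : ∀ s, r ≤ s → s < r + m → B.Ready S ⟨p.1, p.2, v p.1⟩ s := by
      intro s h₁ h₂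
      refine ⟨h₁, fun hc => ?_, fun w e => absurd e (DagTask.not_edge_of_size (hsingle _) _ _), ?_⟩
      · exact absurd (hc.mono h₂.le) (not_le.mpr hinc)
      · intro j hj w
        -- Earlier dag-jobs of the task are due by `r < d`, hence on time by `hd`.
        have hdl : B.deadline p.1 j ≤ r := B.deadline_le_release_of_lt p.1 hj
        exact (hd p.1 j (by omega) w).mono (hdl.trans h₁)
    have h₁ := hS.sum_received_add_ge v hsingle hp r m hready
    have h₂ := ih r hrt (by omega)
    have h₃ := B.sum_fluid_add_le v (B.dueBy d) r m
    have hM' : (0 : ℝ) ≤ M - 1 := sub_nonneg.mpr (Nat.one_le_cast.mpr hM)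
    have h₄ : (M - 1 : ℝ) * ((received S ⟨p.1, p.2, v p.1⟩ (r + m) : ℝ) -
        received S ⟨p.1, p.2, v p.1⟩ r) ≤ (M - 1) * (τ.utilMax * m) := by
      apply mul_le_mul_of_nonneg_left _ hM'
      have := mul_le_mul_of_nonneg_right (util_le_utilMax τ p.1) (Nat.cast_nonneg (α := ℝ) m)
      have h0 : (0 : ℝ) ≤ received S ⟨p.1, p.2, v p.1⟩ r := Nat.cast_nonneg _
      linarith
    have h₅ := mul_le_mul_of_nonneg_right hU (Nat.cast_nonneg (α := ℝ) m)
    linarith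

end Behaviour

theorem schedulable_of_densityTest {M : ℕ} (hM : 1 ≤ M) (hsingle : ∀ i, (τ i).size = 1)
    (hU : τ.DensityTest M) : τ.Schedulable M := by
  intro B S hS
  suffices h : ∀ d i j, B.deadline i j = d → B.DagJobCompleted S i j d from
    fun i j => h _ i j rfl
  intro d
  induction d using Nat.strong_induction_on with
  | _ d ih =>
    intro i j hij w
    let v : ∀ i, Fin (τ i).size := fun i => ⟨0, by rw [hsingle i]; exact Nat.one_pos⟩
    obtain rfl : w = v i := DagTask.subsingleton_of_size (hsingle i) _ _
    have h := hS.sum_fluid_le_sum_received v hM hsingle hU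
      (fun i j hlt => ih _ hlt i j rfl) (le_refl d)
    rw [Finset.sum_congr rfl fun q hq => B.fluid_deadline ⟨q.1, q.2, v q.1⟩
      (B.mem_dueBy.mp hq)] at h
    by_contra hc
    exact absurd h (not_le.mpr (Finset.sum_lt_sum
      (fun q _ => Nat.cast_le.mpr (hS.received_le_exec ⟨q.1, q.2, v q.1⟩ d))
      ⟨(i, j), B.mem_dueBy.mpr hij.le, Nat.cast_lt.mpr (not_le.mp hc)⟩))

/-! ### Comparison of the two tests -/

theorem dagTestAt_iff_densityTest (τ : DagSystem n) (M : ℕ) {k : Fin n}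
    (hk : (τ k).cpUtil = τ.utilMax) : τ.DagTestAt M k ↔ τ.DensityTest M := by
  have h : ∀ i, τ.eta k i = (τ i).util := fun i => if_pos (hk ▸ util_le_utilMax τ i)
  unfold DagTestAt DensityTest utilSum
  simp only [h, hk]

end DagSystem

theorem mainTheorem2 {n : ℕ} (τ : DagSystem n) (M : ℕ) (hM : 1 ≤ M)
    (hsingle : ∀ i, (τ i).size = 1) :
    (τ.utilSum ≤ (M : ℝ) - ((M : ℝ) - 1) * τ.utilMax → τ.Schedulable M) ∧
    (∀ i, (τ i).cpUtil = (τ i).util) ∧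
    τ.cpUtilMax = τ.utilMax ∧
    (∀ k, (τ k).cpUtil = τ.cpUtilMax → (τ.DagTestAt M k ↔ τ.DensityTest M)) ∧
    (τ.DagTest M → τ.DensityTest M) := by
  have hσ : ∀ i, (τ i).cpUtil = (τ i).util := fun i => DagTask.cpUtil_eq_util (hsingle i)
  have hmax : τ.cpUtilMax = τ.utilMax := iSup_congr hσ
  refine ⟨DagSystem.schedulable_of_densityTest hM hsingle, hσ, hmax,
    fun k hk => DagSystem.dagTestAt_iff_densityTest τ M (hk.trans hmax), fun h => ?_⟩
  rcases isEmpty_or_nonempty (Fin n) with he | hne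
  -- Without tasks the real supremum defaults to `0`, leaving `0 ≤ M`.
  · simp [DagSystem.DensityTest, DagSystem.utilSum, DagSystem.utilMax]
  · obtain ⟨k, hk⟩ := exists_eq_ciSup_of_finite (f := fun i => (τ i).util)
    exact (DagSystem.dagTestAt_iff_densityTest τ M ((hσ k).trans hk)).mp (h k)
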